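/- **Quantum Noiseless Coding Theorem (Schumacher).** *Source.* Let $H_M$ be a finite-dimensional Hilbert space. A quantum signal source $M$ emits independently, with probability $p(a)$ each time, signals $a$ from a finite alphabet, which are pure states $|a\rangle\in H_M$ (unit vectors). Its density operator is $\rho_M=\sum_a p(a)|a\rangle\langle a|$, with von Neumann entropy $S(\rho_M)=-\mathrm{Tr}(\rho_M\log_2\rho_M)$. A group of $n$ signals $\mathbf a=(a_1,\dots,a_n)$ has probability $p(\mathbf a)=p(a_1)\cdots p(a_n)$ and state $|\mathbf a\rangle=|a_1\rangle\otimes\cdots\otimes|a_n\rangle\in H_M^{\otimes n}$. *Transposition.* A transposition scheme for groups of $n$ signals with code system $H_C$, $\dim H_C=d$, consists of a finite-dimensional Hilbert space $H\supseteq H_M^{\otimes n}$, an ancilla $H_E$ with a standard unit vector $|0\rangle$, a unitary encoding $U:H\to H_C\otimes H_E$ and a unitary decoding $V:H_C\otimes H_E\to H$. Only $H_C$ is conveyed: the signal $\mathbf a$ becomes $\Pi_{\mathbf a}=U|\mathbf a\rangle\langle\mathbf a|U^{-1}$, the ancilla is discarded and replaced by a fresh one in its standard state, giving $W_{\mathbf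 a}=\mathrm{Tr}_E\Pi_{\mathbf a}\otimes|0\rangle\langle 0|$, and the decoded state is $\rho_{\mathbf a}=VW_{\mathbf a}V^{-1}$. The average fidelity is $\bar F=\sum_{\mathbf a}p(\mathbf a)\,\mathrm{Tr}\,|\mathbf a\rangle\langle\mathbf a|\,\rho_{\mathbf a}$. *Theorem.* Let $\delta,\epsilon>0$. (i) For all sufficiently large $n$ there is a transposition scheme for groups of $n$ signals whose code system consists of $\lfloor n(S(\rho_M)+\delta)\rfloor$ qubits, i.e. $d=2^{\lfloor n(S(\rho_M)+\delta)\rfloor}$, whose decoding is the inverse $V=U^{-1}$ of the encoding, and whose average fidelity satisfies $\bar F>1-\epsilon$. (ii) For all sufficiently large $n$, every transposition scheme for groups of $n$ signals with code system of dimension $d\le 2^{n(S(\rho_M)-\delta)}$ (at most $S(\rho_M)-\delta$ qubits per signal), with arbitrary unitary encoding and decoding, has average fidelity $\bar F<\epsilon$. -/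

import Mathlib

open Filter
open scoped Matrix Kronecker

noncomputable section

/-- The operator `|v⟩⟨v|` on the finite-dimensional Hilbert space `ℂ^ι`. -/
def ketBra {ι : Type*} (v : EuclideanSpace ℂ ι) : Matrix ι ι ℂ :=
  Matrix.of fun i j => v i * star (v j)

/-- A quantum signal source on the Hilbert space `ℂ^ι`: signals `a` from a finite alphabet `A`
occur with probability `prob a` and are pure states, given by unit vectors `state a`. -/
structure QuantumSource (A ι : Type*) [Fintype A] [Fintype ι] where
  prob : A → ℝ
  prob_nonneg : ∀ a, 0 ≤ prob a
  prob_sum : ∑ a, prob a = 1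
  state : A → EuclideanSpace ℂ ι
  state_norm : ∀ a, ‖state a‖ = 1

/-- The von Neumann entropy `S(ρ) = -Tr (ρ log₂ ρ)`; the logarithm is taken in the functional
calculus of Hermitian matrices (eigenvalue `0` contributes `0 · log₂ 0 = 0`). -/
def vonNeumannEntropy {ι : Type*} [Fintype ι] [DecidableEq ι] (ρ : Matrix ι ι ℂ) : ℝ :=
  -(Matrix.trace (ρ * cfc (Real.logb 2) ρ)).re

namespace QuantumSource

variable {A ι : Type*} [Fintype A] [Fintype ι]

/-- The density operator `ρ_M = ∑ₐ p(a) |a⟩⟨a|` of the signal ensemble. -/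
def density (M : QuantumSource A ι) : Matrix ι ι ℂ :=
  ∑ a, (M.prob a : ℂ) • ketBra (M.state a)

/-- Blocks of `n` independent signals: the word `a₁ … aₙ` has probability `p(a₁) ⋯ p(aₙ)` and
state `|a₁⟩ ⊗ ⋯ ⊗ |aₙ⟩` in `(ℂ^ι)^{⊗n} = ℂ^(ι^n)`. -/
def block (M : QuantumSource A ι) (n : ℕ) : QuantumSource (Fin n → A) (Fin n → ι) where
  prob a := ∏ k, M.prob (a k)
  prob_nonneg a := Finset.prod_nonneg fun k _ => M.prob_nonneg (a k)
  prob_sum := by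
    classical
    rw [← Fintype.piFinset_univ, ← Finset.prod_univ_sum]
    simp [M.prob_sum]
  state a := WithLp.toLp 2 fun i => ∏ k, M.state (a k) (i k)
  state_norm a := by
    classical
    have h : ∀ k, ∑ i, ‖M.state (a k) i‖ ^ 2 = 1 := fun k => by
      rw [← EuclideanSpace.norm_sq_eq, M.state_norm, one_pow]
    rw [EuclideanSpace.norm_eq, Real.sqrt_eq_one]
    simp only [norm_prod, ← Finset.prod_pow]
    rw [← Fintype.piFinset_univ,
      ← Finset.prod_univ_sum (fun _ : Fin n => (Finset.univ : Finset ι))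
        (fun k i => ‖M.state (a k) i‖ ^ 2)]
    simp [h]

end QuantumSource

/-- The partial trace over the second factor of `H_C ⊗ H_E`. -/
def partialTraceRight {γ η : Type*} [Fintype η] (X : Matrix (γ × η) (γ × η) ℂ) : Matrix γ γ ℂ :=
  Matrix.of fun c c' => ∑ e, X (c, e) (c', e)

/-- A scheme for the approximate transposition of messages in `H_M = ℂ^μ` through a code system
`H_C` of dimension `d`, with unitary encoding and unitary decoding.  The message space is a
subspace, via the isometry `incl`, of a system space `H = ℂ^s`.  The transmission system is
`H_C ⊗ H_E` with an ancilla `H_E` of dimension `e`.  Alice applies the unitary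
`encode : H → H_C ⊗ H_E` and discards `H_E`; Bob attaches a fresh copy of the ancilla in the
standard state `std` and applies the unitary `decode : H_C ⊗ H_E → H`. -/
structure TranspositionScheme (μ : Type*) [Fintype μ] [DecidableEq μ] (d : ℕ) where
  s : ℕ
  e : ℕ
  incl : Matrix (Fin s) μ ℂ
  incl_isometry : inclᴴ * incl = 1
  encode : Matrix (Fin d × Fin e) (Fin s) ℂ
  encode_isometry : encodeᴴ * encode = 1
  encode_coisometry : encode * encodeᴴ = 1
  decode : Matrix (Fin s) (Fin d × Fin e) ℂ
  decode_isometry : decodeᴴ * decode = 1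
  decode_coisometry : decode * decodeᴴ = 1
  std : EuclideanSpace ℂ (Fin e)
  std_norm : ‖std‖ = 1

namespace TranspositionScheme

variable {A μ : Type*} [Fintype A] [Fintype μ] [DecidableEq μ] {d : ℕ}

/-- Bob decodes with the inverse of Alice's coding operation. -/
def DecodesByInverse (T : TranspositionScheme μ d) : Prop :=
  T.decode * T.encode = 1

/-- A state of the message space, as a state of the system space. -/
def embed (T : TranspositionScheme μ d) (σ : Matrix μ μ ℂ) : Matrix (Fin T.s) (Fin T.s) ℂ :=
  T.incl * σ * T.inclᴴ

/-- The state `Π = U σ U⁻¹` of `H_C ⊗ H_E` after encoding. -/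
def encoded (T : TranspositionScheme μ d) (σ : Matrix μ μ ℂ) :
    Matrix (Fin d × Fin T.e) (Fin d × Fin T.e) ℂ :=
  T.encode * T.embed σ * T.encodeᴴ

/-- The state `W = Tr_E Π ⊗ |0⟩⟨0|` that Bob holds before decoding. -/
def received (T : TranspositionScheme μ d) (σ : Matrix μ μ ℂ) :
    Matrix (Fin d × Fin T.e) (Fin d × Fin T.e) ℂ :=
  partialTraceRight (T.encoded σ) ⊗ₖ ketBra T.std

/-- The final state after decoding. -/
def decoded (T : TranspositionScheme μ d) (σ : Matrix μ μ ℂ) : Matrix (Fin T.s) (Fin T.s) ℂ :=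
  T.decode * T.received σ * T.decodeᴴ

/-- The average fidelity `∑ₐ p(a) Tr (|a⟩⟨a| ρₐ)`, where `ρₐ` is the state decoded when the signal
`a` has been sent.  (The trace of a product of positive operators is real.) -/
def fidelity (T : TranspositionScheme μ d) (M : QuantumSource A μ) : ℝ :=
  ∑ a, M.prob a *
    (Matrix.trace (T.embed (ketBra (M.state a)) * T.decoded (ketBra (M.state a)))).re

end TranspositionScheme

end

/-!
The density operator of a block of `n` signals is the tensor power of `ρ_M`, so it is diagonal in
the product of eigenbases of `ρ_M`, with eigenvalues `q i₁ ⋯ q iₙ` where `q` is the spectrum of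
`ρ_M`. The von Neumann entropy of `ρ_M` is the Shannon entropy of `q`, and by Chebyshev's inequality
almost all of the weight lies on the typical words, each of weight `2 ^ (-n (S ± t))`
(`eventually_sum_compl_typicalSet_lt`); there are at most `2 ^ (n (S + t))` of them
(`card_typicalSet_le`).

For a message `v` the fidelity is `∑ f, |⟨z, x_f⟩|²`
(`TranspositionScheme.trace_embed_mul_decoded_re`), where `x_f = (1 ⊗ ⟨f|) U v` is the component of
the encoded message at the basis state `f` of the ancilla and `z = (1 ⊗ ⟨0|) V⁻¹ v`.

*Achievability* (`TranspositionScheme.exists_fidelity_ge`). A unitary that sends the typical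
eigenvectors into `H_C ⊗ |0⟩`, with its inverse as decoding, has `z = x_0`. The term `f = 0` alone
gives fidelity at least `‖x_0‖⁴ ≥ 2 ‖x_0‖² - 1`, and `‖x_0‖²` is at least the weight of `v` on the
typical subspace. On average this is close to `1`.

*Converse* (`TranspositionScheme.fidelity_le`). By Cauchy–Schwarz the fidelity is at most `‖z‖²`,
whatever the encoding. The map `R : v ↦ z` is a contraction into a space of dimension `d`, so the
average of `‖z‖²` is `∑ i, w i * g i` with `w` the eigenvalues of the block density operator,
`0 ≤ g ≤ 1` and `∑ g ≤ d`. The atypical words contribute at most their total weight, and the typical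
ones at most `d` times the largest typical eigenvalue; this product is at most
`2 ^ (-n δ / 2)` when `t = δ / 2` and `d ≤ 2 ^ (n (S - δ))`.
-/

noncomputable section

/-! ### Contractions in the operator norm -/

section Contraction

open scoped Matrix.Norms.L2Operator

variable {m n : Type*} [Fintype m] [Fintype n] [DecidableEq n]

theorem Matrix.norm_le_one_of_conjTranspose_mul_self {A : Matrix m n ℂ} (h : Aᴴ * A = 1) :
    ‖A‖ ≤ 1 := by
  have h1 := Matrix.l2_opNorm_conjTranspose_mul_self A
  have h2 : ‖(1 : Matrix n n ℂ)‖ ≤ 1 := by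
    rw [← Matrix.diagonal_one, Matrix.l2_opNorm_diagonal]
    exact (pi_norm_le_iff_of_nonneg zero_le_one).2 fun i => by simp
  rw [h] at h1
  nlinarith [norm_nonneg A]

theorem Matrix.norm_le_one_of_mul_conjTranspose_self [DecidableEq m]
    {A : Matrix m n ℂ} (h : A * Aᴴ = 1) :
    ‖A‖ ≤ 1 := by
  rw [← Matrix.l2_opNorm_conjTranspose]
  exact Matrix.norm_le_one_of_conjTranspose_mul_self (by rw [Matrix.conjTranspose_conjTranspose, h])

theorem Matrix.sum_norm_sq_mulVec_le {A : Matrix m n ℂ} (h : ‖A‖ ≤ 1) (v : n → ℂ) :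
    ∑ i, ‖(A *ᵥ v) i‖ ^ 2 ≤ ∑ j, ‖v j‖ ^ 2 := by
  have h1 := A.l2_opNorm_mulVec (WithLp.toLp 2 v)
  have h2 := h1.trans (mul_le_of_le_one_left (norm_nonneg _) h)
  have h3 := pow_le_pow_left₀ (norm_nonneg _) h2 2
  rw [EuclideanSpace.norm_sq_eq, EuclideanSpace.norm_sq_eq] at h3
  simpa using h3

theorem Matrix.sum_norm_sq_col_le {A : Matrix m n ℂ} (h : ‖A‖ ≤ 1) (j : n) :
    ∑ i, ‖A i j‖ ^ 2 ≤ 1 := by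
  have := Matrix.sum_norm_sq_mulVec_le h (Pi.single j 1)
  refine this.trans' (le_of_eq ?_) |>.trans (le_of_eq ?_)
  · simp
  · rw [Finset.sum_eq_single j] <;> simp +contextual

theorem Matrix.sum_norm_sq_row_le [DecidableEq m] {A : Matrix m n ℂ} (h : ‖A‖ ≤ 1) (i : m) :
    ∑ j, ‖A i j‖ ^ 2 ≤ 1 := by
  have := Matrix.sum_norm_sq_col_le (A := Aᴴ) (by rwa [Matrix.l2_opNorm_conjTranspose]) i
  simpa using this

end Contraction

/-! ### The fidelity of a single signal -/

theorem ketBra_eq_vecMulVec {ι : Type*} (v : EuclideanSpace ℂ ι) :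
    ketBra v = Matrix.vecMulVec v (star v) := by
  ext i j
  simp [ketBra, Matrix.vecMulVec_apply]

theorem Matrix.mul_vecMulVec_star_mul_conjTranspose {m n : Type*} [Fintype n]
    (A : Matrix m n ℂ) (v : n → ℂ) :
    A * Matrix.vecMulVec v (star v) * Aᴴ = Matrix.vecMulVec (A *ᵥ v) (star (A *ᵥ v)) := by
  rw [Matrix.mul_vecMulVec, Matrix.vecMulVec_mul, Matrix.star_mulVec]

/-- The operator `1 ⊗ ⟨φ| : H_C ⊗ H_E → H_C`. -/
def braRight (γ : Type*) {η : Type*} [DecidableEq γ] (φ : EuclideanSpace ℂ η) :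
    Matrix γ (γ × η) ℂ :=
  Matrix.of fun c p => if c = p.1 then star (φ p.2) else 0

theorem braRight_mulVec {γ η : Type*} [Fintype γ] [DecidableEq γ] [Fintype η]
    (φ : EuclideanSpace ℂ η) (x : γ × η → ℂ) (c : γ) :
    (braRight γ φ *ᵥ x) c = ∑ e, star (φ e) * x (c, e) := by
  simp [braRight, Matrix.mulVec, dotProduct, Fintype.sum_prod_type, ite_mul]

theorem braRight_mul_conjTranspose {γ η : Type*} [Fintype γ] [DecidableEq γ] [Fintype η]
    {φ : EuclideanSpace ℂ η} (hφ : ‖φ‖ = 1) : braRight γ φ * (braRight γ φ)ᴴ = 1 := by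
  have h : ∑ e, (starRingEnd ℂ) (φ e) * φ e = 1 := by
    have h1 : ∑ e, ‖φ e‖ ^ 2 = 1 := by rw [← EuclideanSpace.norm_sq_eq, hφ, one_pow]
    have h2 := congrArg (fun x : ℝ => (x : ℂ)) h1
    simpa [Complex.conj_mul'] using h2
  ext c c'
  by_cases hc : c = c'
  · subst hc
    simp [Matrix.mul_apply, braRight, Fintype.sum_prod_type, apply_ite]
    exact h
  · simp only [Matrix.mul_apply, braRight, Fintype.sum_prod_type, Matrix.one_apply_ne hc]
    refine Finset.sum_eq_zero fun a _ => Finset.sum_eq_zero fun b _ => ?_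
    by_cases h1 : c = a
    · have : ¬ c' = a := fun h2 => hc (h1.trans h2.symm)
      simp [this]
    · simp [h1]

theorem kronecker_ketBra {γ η : Type*} [Fintype γ] [DecidableEq γ] [Fintype η]
    (Y : Matrix γ γ ℂ) (φ : EuclideanSpace ℂ η) :
    Y ⊗ₖ ketBra φ = (braRight γ φ)ᴴ * Y * braRight γ φ := by
  ext ⟨c, e⟩ ⟨c', e'⟩
  simp [Matrix.mul_apply, braRight, ketBra, apply_ite]
  ring

namespace TranspositionScheme

variable {μ : Type*} [Fintype μ] [DecidableEq μ] {d : ℕ}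

/-- The isometry from the message space into `H_C ⊗ H_E` that Alice's coding induces. -/
def encodeMessage (T : TranspositionScheme μ d) : Matrix (Fin d × Fin T.e) μ ℂ :=
  T.encode * T.incl

/-- The operator `(1 ⊗ ⟨0|) V⁻¹` from the message space to `H_C`; its adjoint applies Bob's decoding
to a state of the code system and projects the result onto the message space. -/
def codeAmplitude (T : TranspositionScheme μ d) : Matrix (Fin d) μ ℂ :=
  braRight (Fin d) T.std * T.decodeᴴ * T.incl

/-- Expanding the partial trace over the discarded ancilla writes the fidelity of a single signal
as a sum of squared overlaps, one for each basis state of the ancilla. -/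
theorem trace_embed_mul_decoded_re (T : TranspositionScheme μ d) (v : EuclideanSpace ℂ μ) :
    (Matrix.trace (T.embed (ketBra v) * T.decoded (ketBra v))).re =
      ∑ f, ‖∑ c, star ((T.codeAmplitude *ᵥ v) c) * (T.encodeMessage *ᵥ v) (c, f)‖ ^ 2 := by
  set z := T.codeAmplitude *ᵥ v with hz
  set x := T.encodeMessage *ᵥ v with hx
  have h1 : T.encoded (ketBra v) = Matrix.vecMulVec x (star x) := by
    rw [hx, ← Matrix.mul_vecMulVec_star_mul_conjTranspose, ketBra_eq_vecMulVec]
    simp only [encoded, embed, encodeMessage, Matrix.conjTranspose_mul, Matrix.mul_assoc]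
  set Y := partialTraceRight (Matrix.vecMulVec x (star x)) with hY
  have h2 : Matrix.trace (T.embed (ketBra v) * T.decoded (ketBra v)) =
      Matrix.trace (Matrix.vecMulVec z (star z) * Y) := by
    have hz' : Matrix.vecMulVec z (star z) =
        T.codeAmplitude * ketBra v * T.codeAmplitudeᴴ := by
      rw [hz, ← Matrix.mul_vecMulVec_star_mul_conjTranspose, ketBra_eq_vecMulVec]
    rw [decoded, received, h1, kronecker_ketBra, hz', ← hY]
    set B := braRight (Fin d) T.std with hB
    have e1 : T.embed (ketBra v) * (T.decode * (Bᴴ * Y * B) * T.decodeᴴ) =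
        (T.embed (ketBra v) * T.decode * Bᴴ * Y) * (B * T.decodeᴴ) := by
      simp only [Matrix.mul_assoc]
    rw [e1, Matrix.trace_mul_comm]
    simp only [codeAmplitude, embed, Matrix.conjTranspose_mul, Matrix.conjTranspose_conjTranspose,
      Matrix.mul_assoc, ← hB]
  have h3 : Matrix.trace (Matrix.vecMulVec z (star z) * Y) =
      ∑ f, ((‖∑ c, star (z c) * x (c, f)‖ ^ 2 : ℝ) : ℂ) := by
    calc Matrix.trace (Matrix.vecMulVec z (star z) * Y)
        = ∑ c, ∑ c', ∑ f, (star (z c') * x (c', f)) * star (star (z c) * x (c, f)) := by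
          simp only [hY, Matrix.trace, Matrix.diag, Matrix.mul_apply, Matrix.vecMulVec_apply,
            partialTraceRight, Matrix.of_apply, Finset.mul_sum, Pi.star_apply, star_mul', star_star]
          exact Finset.sum_congr rfl fun c _ => Finset.sum_congr rfl fun c' _ =>
            Finset.sum_congr rfl fun f _ => by ring
      _ = ∑ f, ∑ c', ∑ c, (star (z c') * x (c', f)) * star (star (z c) * x (c, f)) := by
          rw [Finset.sum_comm]
          simp_rw [Finset.sum_comm (s := (Finset.univ : Finset (Fin d)))
            (t := (Finset.univ : Finset (Fin T.e)))]
      _ = _ := by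
          refine Finset.sum_congr rfl fun f _ => ?_
          rw [Complex.ofReal_pow, ← Complex.mul_conj', map_sum, Finset.sum_mul_sum]
          rfl
  rw [h2, h3, ← Complex.ofReal_sum, Complex.ofReal_re]

end TranspositionScheme

/-! ### Mean weights of the signal ensemble -/

theorem QuantumSource.sum_prob_mul_norm_sq_mulVec {A μ κ : Type*} [Fintype A] [Fintype μ]
    (M : QuantumSource A μ) (R : Matrix κ μ ℂ) (c : κ) :
    ((∑ a, M.prob a * ‖(R *ᵥ M.state a) c‖ ^ 2 : ℝ) : ℂ) = (R * M.density * Rᴴ) c c := by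
  simp only [QuantumSource.density, Matrix.mul_sum, Matrix.sum_mul, Matrix.sum_apply,
    Matrix.mul_smul, Matrix.smul_mul, Matrix.smul_apply, ketBra_eq_vecMulVec,
    Matrix.mul_vecMulVec_star_mul_conjTranspose, Matrix.vecMulVec_apply, Pi.star_apply,
    Complex.ofReal_sum, Complex.ofReal_mul, Complex.ofReal_pow, smul_eq_mul]
  exact Finset.sum_congr rfl fun a _ => by rw [← Complex.mul_conj']; rfl

theorem Matrix.mul_diagonal_ofReal_mul_conjTranspose_apply_self {κ μ : Type*} [Fintype μ]
    [DecidableEq μ] (G : Matrix κ μ ℂ) (w : μ → ℝ) (c : κ) :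
    (G * Matrix.diagonal (fun i => (w i : ℂ)) * Gᴴ) c c = ((∑ i, ‖G c i‖ ^ 2 * w i : ℝ) : ℂ) := by
  rw [Matrix.mul_apply, Complex.ofReal_sum]
  refine Finset.sum_congr rfl fun i _ => ?_
  rw [Matrix.mul_diagonal, Matrix.conjTranspose_apply, Complex.ofReal_mul, Complex.ofReal_pow,
    ← Complex.mul_conj']
  simp only [RCLike.star_def]
  ring

namespace QuantumSource

variable {A μ : Type*} [Fintype A] [Fintype μ] [DecidableEq μ]

/-- In an eigenbasis of the density operator, the mean weight of the signals on a basis vector is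
the corresponding eigenvalue. -/
theorem sum_prob_mul_norm_sq_of_diagonal {M : QuantumSource A μ} {W : Matrix μ μ ℂ} {w : μ → ℝ}
    (hw : W * M.density * Wᴴ = Matrix.diagonal fun i => (w i : ℂ)) (i : μ) :
    ∑ a, M.prob a * ‖(W *ᵥ M.state a) i‖ ^ 2 = w i := by
  have := M.sum_prob_mul_norm_sq_mulVec W i
  rw [hw, Matrix.diagonal_apply_eq] at this
  exact_mod_cast this

theorem weight_nonneg_of_diagonal {M : QuantumSource A μ} {W : Matrix μ μ ℂ} {w : μ → ℝ}
    (hw : W * M.density * Wᴴ = Matrix.diagonal fun i => (w i : ℂ)) (i : μ) : 0 ≤ w i := by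
  rw [← sum_prob_mul_norm_sq_of_diagonal hw i]
  exact Finset.sum_nonneg fun a _ => mul_nonneg (M.prob_nonneg a) (sq_nonneg _)

theorem sum_norm_sq_mulVec_state {κ : Type*} [Fintype κ] (M : QuantumSource A μ)
    {K : Matrix κ μ ℂ} (hK : Kᴴ * K = 1) (a : A) : ∑ i, ‖(K *ᵥ M.state a) i‖ ^ 2 = 1 := by
  have h1 : ∑ i, ‖M.state a i‖ ^ 2 = 1 := by
    rw [← EuclideanSpace.norm_sq_eq, M.state_norm, one_pow]
  have h2 : star (K *ᵥ M.state a) ⬝ᵥ (K *ᵥ M.state a) = star (M.state a).ofLp ⬝ᵥ (M.state a) := by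
    rw [Matrix.star_mulVec, Matrix.dotProduct_mulVec, Matrix.vecMul_vecMul, hK, Matrix.vecMul_one]
  simp only [dotProduct, Pi.star_apply, RCLike.star_def, Complex.conj_mul'] at h2
  rw [← h1]
  exact_mod_cast h2

theorem sum_weight_of_diagonal {M : QuantumSource A μ} {W : Matrix μ μ ℂ} {w : μ → ℝ}
    (hW : Wᴴ * W = 1) (hw : W * M.density * Wᴴ = Matrix.diagonal fun i => (w i : ℂ)) :
    ∑ i, w i = 1 := by
  simp only [← sum_prob_mul_norm_sq_of_diagonal hw]
  rw [Finset.sum_comm]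
  simp only [← Finset.mul_sum, M.sum_norm_sq_mulVec_state hW, mul_one, M.prob_sum]

end QuantumSource

/-! ### Coding bounds in the eigenbasis of the density operator -/

/-- The linear map `ℂ^μ → ℂ^κ` that sends the basis vector `i` to the basis vector `j i`. -/
def basisEmbedding {μ κ : Type*} [DecidableEq κ] (j : μ → κ) : Matrix κ μ ℂ :=
  Matrix.of fun k i => if k = j i then 1 else 0

theorem basisEmbedding_isometry {μ κ : Type*} [Fintype κ] [DecidableEq κ] [DecidableEq μ]
    {j : μ → κ} (hj : Function.Injective j) :
    (basisEmbedding j)ᴴ * basisEmbedding j = 1 := by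
  ext i i'
  simp [basisEmbedding, Matrix.mul_apply, Matrix.one_apply, apply_ite, hj.eq_iff, eq_comm]

theorem basisEmbedding_mulVec_apply {μ κ : Type*} [Fintype μ] [DecidableEq κ]
    [DecidableEq μ] {j : μ → κ} (hj : Function.Injective j) (v : μ → ℂ) (i : μ) :
    (basisEmbedding j *ᵥ v) (j i) = v i := by
  simp [basisEmbedding, Matrix.mulVec, dotProduct, hj.eq_iff]

/-- An injection of the index set into the basis of `H_C ⊗ H_E` (with `H_E` large enough) that
maps `S` into `H_C ⊗ |0⟩`. -/
theorem exists_injective_zero_on {μ : Type*} [Fintype μ] [DecidableEq μ] {d : ℕ}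
    (hd : 0 < d) (S : Finset μ) (hS : S.card ≤ d) :
    ∃ j : μ → Fin d × Fin (Fintype.card μ + 1), Function.Injective j ∧ ∀ i ∈ S, (j i).2 = 0 := by
  let f : S → Fin d := fun i => Fin.castLE hS (S.equivFin i)
  have hf : Function.Injective f := (Fin.castLE_injective hS).comp S.equivFin.injective
  refine ⟨fun i => if h : i ∈ S then (f ⟨i, h⟩, 0) else
    (⟨0, hd⟩, Fin.succ (Fintype.equivFin μ i)), fun i i' h => ?_, fun i hi => by simp [hi]⟩
  by_cases hi : i ∈ S <;> by_cases hi' : i' ∈ S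
  · simpa [hi, hi', hf.eq_iff] using h
  · simp [hi, hi', Fin.ext_iff] at h
  · simp [hi, hi', Fin.ext_iff] at h
  · simpa [hi, hi'] using h

namespace TranspositionScheme

variable {A μ : Type*} [Fintype A] [Fintype μ] [DecidableEq μ] {d : ℕ}

theorem encodeMessage_isometry (T : TranspositionScheme μ d) :
    T.encodeMessageᴴ * T.encodeMessage = 1 := by
  rw [encodeMessage, Matrix.conjTranspose_mul, Matrix.mul_assoc, ← Matrix.mul_assoc T.encodeᴴ,
    T.encode_isometry, Matrix.one_mul, T.incl_isometry]

section

open scoped Matrix.Norms.L2Operator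

theorem norm_codeAmplitude_le_one (T : TranspositionScheme μ d) : ‖T.codeAmplitude‖ ≤ 1 := by
  have h1 : ‖braRight (Fin d) T.std‖ ≤ 1 :=
    Matrix.norm_le_one_of_mul_conjTranspose_self (braRight_mul_conjTranspose T.std_norm)
  have h2 : ‖T.decodeᴴ‖ ≤ 1 := by
    rw [Matrix.l2_opNorm_conjTranspose]
    exact Matrix.norm_le_one_of_conjTranspose_mul_self T.decode_isometry
  have h3 : ‖T.incl‖ ≤ 1 := Matrix.norm_le_one_of_conjTranspose_mul_self T.incl_isometry
  refine (Matrix.l2_opNorm_mul _ _).trans (mul_le_one₀ ?_ (norm_nonneg _) h3)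
  exact (Matrix.l2_opNorm_mul _ _).trans (mul_le_one₀ h1 (norm_nonneg _) h2)

/-- The state `ω` of the code system satisfies `ω ≤ 1`, so whatever is decoded is dominated by the
projection onto the `d`-dimensional range of Bob's preparations `V (· ⊗ |0⟩)`. -/
theorem trace_embed_mul_decoded_re_le (T : TranspositionScheme μ d) (M : QuantumSource A μ)
    (a : A) :
    (Matrix.trace (T.embed (ketBra (M.state a)) * T.decoded (ketBra (M.state a)))).re ≤
      ∑ c, ‖(T.codeAmplitude *ᵥ M.state a) c‖ ^ 2 := by
  rw [trace_embed_mul_decoded_re]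
  set z := T.codeAmplitude *ᵥ M.state a
  set x := T.encodeMessage *ᵥ M.state a with hx
  have hx1 : ∑ f, ∑ c, ‖x (c, f)‖ ^ 2 = 1 := by
    rw [Finset.sum_comm, ← Fintype.sum_prod_type (f := fun p => ‖x p‖ ^ 2)]
    exact M.sum_norm_sq_mulVec_state T.encodeMessage_isometry a
  calc ∑ f, ‖∑ c, star (z c) * x (c, f)‖ ^ 2
      ≤ ∑ f, (∑ c, ‖z c‖ ^ 2) * ∑ c, ‖x (c, f)‖ ^ 2 := by
        refine Finset.sum_le_sum fun f _ => ?_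
        refine (pow_le_pow_left₀ (norm_nonneg _) (norm_sum_le _ _) 2).trans ?_
        simp only [norm_mul, norm_star]
        exact Finset.sum_mul_sq_le_sq_mul_sq _ _ _
    _ = ∑ c, ‖z c‖ ^ 2 := by rw [← Finset.mul_sum, hx1, mul_one]

/-- If the eigenvalues `w i` of the signal density operator are at most `t` on a set `S`, then
a code system of dimension `d` transposes the part of the ensemble in `S` with fidelity at most
`d * t`. -/
theorem fidelity_le (T : TranspositionScheme μ d) {M : QuantumSource A μ} {W : Matrix μ μ ℂ}
    {w : μ → ℝ} (hW : W * Wᴴ = 1) (hW' : Wᴴ * W = 1)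
    (hw : W * M.density * Wᴴ = Matrix.diagonal fun i => (w i : ℂ)) (S : Finset μ) {t : ℝ}
    (ht : 0 ≤ t) (hS : ∀ i ∈ S, w i ≤ t) : T.fidelity M ≤ ∑ i ∈ Sᶜ, w i + d * t := by
  set G := T.codeAmplitude * Wᴴ with hG
  have hG1 : ‖G‖ ≤ 1 := by
    refine (Matrix.l2_opNorm_mul _ _).trans
      (mul_le_one₀ T.norm_codeAmplitude_le_one (norm_nonneg _) ?_)
    rw [Matrix.l2_opNorm_conjTranspose]
    exact Matrix.norm_le_one_of_mul_conjTranspose_self hW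
  have hρ : M.density = Wᴴ * Matrix.diagonal (fun i => (w i : ℂ)) * W := by
    rw [← hw, ← Matrix.mul_assoc, ← Matrix.mul_assoc, hW', Matrix.one_mul, Matrix.mul_assoc, hW',
      Matrix.mul_one]
  have hc (c : Fin d) : ∑ a, M.prob a * ‖(T.codeAmplitude *ᵥ M.state a) c‖ ^ 2 =
      ∑ i, ‖G c i‖ ^ 2 * w i := by
    have h := M.sum_prob_mul_norm_sq_mulVec T.codeAmplitude c
    have h' := Matrix.mul_diagonal_ofReal_mul_conjTranspose_apply_self G w c
    have e : T.codeAmplitude * M.density * T.codeAmplitudeᴴ =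
        G * Matrix.diagonal (fun i => (w i : ℂ)) * Gᴴ := by
      rw [hρ, hG, Matrix.conjTranspose_mul, Matrix.conjTranspose_conjTranspose]
      simp only [Matrix.mul_assoc]
    rw [e, h'] at h
    exact_mod_cast h
  have h1 : T.fidelity M ≤ ∑ i, ∑ c, ‖G c i‖ ^ 2 * w i := by
    rw [Finset.sum_comm]
    simp only [← hc]
    rw [Finset.sum_comm]
    simp only [← Finset.mul_sum]
    exact Finset.sum_le_sum fun a _ =>
      mul_le_mul_of_nonneg_left (T.trace_embed_mul_decoded_re_le M a) (M.prob_nonneg a)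
  rw [← Finset.sum_compl_add_sum S] at h1
  refine h1.trans (add_le_add ?_ ?_)
  · refine Finset.sum_le_sum fun i _ => ?_
    rw [← Finset.sum_mul]
    exact mul_le_of_le_one_left (QuantumSource.weight_nonneg_of_diagonal hw i)
      (Matrix.sum_norm_sq_col_le hG1 i)
  · calc ∑ i ∈ S, ∑ c, ‖G c i‖ ^ 2 * w i ≤ ∑ i ∈ S, ∑ c, ‖G c i‖ ^ 2 * t :=
          Finset.sum_le_sum fun i hi => Finset.sum_le_sum fun c _ =>
            mul_le_mul_of_nonneg_left (hS i hi) (sq_nonneg _)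
      _ ≤ ∑ i, ∑ c, ‖G c i‖ ^ 2 * t :=
          Finset.sum_le_univ_sum_of_nonneg fun i =>
            Finset.sum_nonneg fun c _ => mul_nonneg (sq_nonneg _) ht
      _ = ∑ c, (∑ i, ‖G c i‖ ^ 2) * t := by
          rw [Finset.sum_comm]
          simp only [Finset.sum_mul]
      _ ≤ ∑ _c : Fin d, t :=
          Finset.sum_le_sum fun c _ =>
            mul_le_of_le_one_left ht (Matrix.sum_norm_sq_row_le hG1 c)
      _ = d * t := by simp

end

/-- The encoding sends the eigenvectors in `S` into `H_C ⊗ |0⟩`, where the replacement of the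
ancilla has no effect, so that only the part of a signal outside their span is damaged. -/
theorem exists_fidelity_ge {M : QuantumSource A μ} {W : Matrix μ μ ℂ}
    {w : μ → ℝ} (hW : Wᴴ * W = 1)
    (hw : W * M.density * Wᴴ = Matrix.diagonal fun i => (w i : ℂ)) (hd : 0 < d) (S : Finset μ)
    (hS : S.card ≤ d) :
    ∃ T : TranspositionScheme μ d, T.DecodesByInverse ∧ 2 * ∑ i ∈ S, w i - 1 ≤ T.fidelity M := by
  obtain ⟨j, hj, hj0⟩ := exists_injective_zero_on hd S hS
  let e := Fintype.card μ + 1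
  let σ : Fin d × Fin e ≃ Fin (d * e) := finProdFinEquiv
  have hU := basisEmbedding_isometry σ.symm.injective
  have hU' := (Matrix.mul_eq_one_comm_of_equiv σ.symm).1 hU
  let T : TranspositionScheme μ d :=
    { s := d * e
      e := e
      incl := (basisEmbedding σ.symm)ᴴ * (basisEmbedding j * W)
      incl_isometry := by
        rw [Matrix.conjTranspose_mul, Matrix.conjTranspose_conjTranspose, Matrix.mul_assoc,
          ← Matrix.mul_assoc (basisEmbedding σ.symm), hU', Matrix.one_mul,
          Matrix.conjTranspose_mul, Matrix.mul_assoc, ← Matrix.mul_assoc (basisEmbedding j)ᴴ,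
          basisEmbedding_isometry hj, Matrix.one_mul, hW]
      encode := basisEmbedding σ.symm
      encode_isometry := hU
      encode_coisometry := hU'
      decode := (basisEmbedding σ.symm)ᴴ
      decode_isometry := by rw [Matrix.conjTranspose_conjTranspose, hU']
      decode_coisometry := by rw [Matrix.conjTranspose_conjTranspose, hU]
      std := EuclideanSpace.single 0 1
      std_norm := by simp }
  refine ⟨T, hU, ?_⟩
  have hL : T.encodeMessage = basisEmbedding j * W := by
    simp only [encodeMessage, T]
    rw [← Matrix.mul_assoc, hU', Matrix.one_mul]
  have hR : T.codeAmplitude = braRight (Fin d) (EuclideanSpace.single (0 : Fin e) 1) *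
      T.encodeMessage := by
    simp only [encodeMessage, codeAmplitude, T, Matrix.conjTranspose_conjTranspose,
      Matrix.mul_assoc]
  have key (a : A) : 2 * ∑ i ∈ S, ‖(W *ᵥ M.state a) i‖ ^ 2 - 1 ≤
      (Matrix.trace (T.embed (ketBra (M.state a)) * T.decoded (ketBra (M.state a)))).re := by
    rw [trace_embed_mul_decoded_re]
    set x := T.encodeMessage *ᵥ M.state a with hx
    have hz (c : Fin d) : (T.codeAmplitude *ᵥ M.state a) c = x (c, (0 : Fin e)) := by
      rw [hR, ← Matrix.mulVec_mulVec, ← hx, braRight_mulVec]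
      simp [PiLp.single_apply, apply_ite, ite_mul]
    have hxj (i : μ) : x (j i) = (W *ᵥ M.state a) i := by
      rw [hx, hL, ← Matrix.mulVec_mulVec, basisEmbedding_mulVec_apply hj]
    have h0 : ∑ i ∈ S, ‖(W *ᵥ M.state a) i‖ ^ 2 ≤ ∑ c, ‖x (c, (0 : Fin e))‖ ^ 2 := by
      have hinj : Set.InjOn (fun i => (j i).1) S := fun i hi i' hi' h =>
        hj (Prod.ext h ((hj0 i hi).trans (hj0 i' hi').symm))
      calc ∑ i ∈ S, ‖(W *ᵥ M.state a) i‖ ^ 2 = ∑ i ∈ S, ‖x ((j i).1, (0 : Fin e))‖ ^ 2 :=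
            Finset.sum_congr rfl fun i hi => by rw [← hxj, ← hj0 i hi]
        _ = ∑ c ∈ S.image fun i => (j i).1, ‖x (c, (0 : Fin e))‖ ^ 2 :=
            (Finset.sum_image (f := fun c => ‖x (c, (0 : Fin e))‖ ^ 2) hinj).symm
        _ ≤ _ := Finset.sum_le_univ_sum_of_nonneg fun c => sq_nonneg _
    -- only the term of the ancilla state `|0⟩` is kept
    have h1 : (∑ c, ‖x (c, (0 : Fin e))‖ ^ 2) ^ 2 ≤
        ∑ f, ‖∑ c, star ((T.codeAmplitude *ᵥ M.state a) c) * x (c, f)‖ ^ 2 := by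
      refine le_trans (le_of_eq ?_) (Finset.single_le_sum (f := fun f =>
        ‖∑ c, star ((T.codeAmplitude *ᵥ M.state a) c) * x (c, f)‖ ^ 2)
        (fun f _ => sq_nonneg _) (Finset.mem_univ (0 : Fin e)))
      simp only [hz, RCLike.star_def, Complex.conj_mul']
      norm_cast
      rw [Real.norm_eq_abs, sq_abs]
    -- `y ^ 2 ≥ 2 * y - 1` turns the squared overlap into a bound linear in the state
    nlinarith [sq_nonneg (∑ c, ‖x (c, (0 : Fin e))‖ ^ 2 - 1)]
  calc 2 * ∑ i ∈ S, w i - 1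
      = ∑ a, M.prob a * (2 * ∑ i ∈ S, ‖(W *ᵥ M.state a) i‖ ^ 2 - 1) := by
        simp only [← QuantumSource.sum_prob_mul_norm_sq_of_diagonal hw]
        rw [Finset.sum_comm]
        simp only [mul_sub, mul_one, Finset.sum_sub_distrib, M.prob_sum, ← Finset.mul_sum]
        congr 1
        rw [Finset.mul_sum]
        exact Finset.sum_congr rfl fun a _ => by ring
    _ ≤ T.fidelity M :=
        Finset.sum_le_sum fun a _ => mul_le_mul_of_nonneg_left (key a) (M.prob_nonneg a)

end TranspositionScheme

/-! ### Tensor powers -/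

theorem Finset.sum_pi_prod {ι R : Type*} [Fintype ι] [CommSemiring R] (n : ℕ)
    (f : Fin n → ι → R) : ∑ i : Fin n → ι, ∏ k, f k (i k) = ∏ k, ∑ x, f k x := by
  classical
  rw [← Fintype.piFinset_univ, ← Finset.prod_univ_sum]

/-- The tensor power `X ⊗ ⋯ ⊗ X` (`n` factors) as an operator on `(ℂ^ι)^{⊗n} = ℂ^(ι^n)`. -/
def tensorPower {ι : Type*} (n : ℕ) (X : Matrix ι ι ℂ) : Matrix (Fin n → ι) (Fin n → ι) ℂ :=
  Matrix.of fun i j => ∏ k, X (i k) (j k)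

section TensorPower

variable {ι : Type*} (n : ℕ)

theorem tensorPower_mul [Fintype ι] (X Y : Matrix ι ι ℂ) :
    tensorPower n (X * Y) = tensorPower n X * tensorPower n Y := by
  ext i j
  simp only [tensorPower, Matrix.mul_apply, Matrix.of_apply, ← Finset.prod_mul_distrib]
  exact (Finset.sum_pi_prod n fun k x => X (i k) x * Y x (j k)).symm

theorem tensorPower_conjTranspose (X : Matrix ι ι ℂ) :
    tensorPower n Xᴴ = (tensorPower n X)ᴴ := by
  ext i j
  simp [tensorPower]

theorem tensorPower_diagonal [DecidableEq ι] (v : ι → ℂ) :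
    tensorPower n (Matrix.diagonal v) = Matrix.diagonal fun i => ∏ k, v (i k) := by
  ext i j
  by_cases h : i = j
  · subst h
    simp [tensorPower]
  · obtain ⟨k, hk⟩ := Function.ne_iff.1 h
    rw [Matrix.diagonal_apply_ne _ h]
    exact Finset.prod_eq_zero (Finset.mem_univ k) (Matrix.diagonal_apply_ne _ hk)

theorem tensorPower_one [DecidableEq ι] : tensorPower n (1 : Matrix ι ι ℂ) = 1 := by
  rw [← Matrix.diagonal_one, tensorPower_diagonal]
  simp

theorem QuantumSource.density_block {A : Type*} [Fintype A] [Fintype ι] (M : QuantumSource A ι) :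
    (M.block n).density = tensorPower n M.density := by
  ext i j
  simp only [QuantumSource.density, QuantumSource.block, Matrix.sum_apply, Matrix.smul_apply,
    smul_eq_mul, ketBra, Matrix.of_apply, tensorPower, star_prod, Complex.ofReal_prod,
    ← Finset.prod_mul_distrib]
  exact Finset.sum_pi_prod n fun k a =>
    (M.prob a : ℂ) * (M.state a (i k) * star (M.state a (j k)))

end TensorPower

/-! ### Entropy of the density operator -/

theorem QuantumSource.isHermitian_density {A ι : Type*} [Fintype A] [Fintype ι]
    (M : QuantumSource A ι) : M.density.IsHermitian := by
  ext i j
  simp [QuantumSource.density, ketBra, Matrix.sum_apply, mul_comm]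

/-- The Shannon entropy, in bits, of a probability vector. -/
def shannonEntropy {ι : Type*} [Fintype ι] (q : ι → ℝ) : ℝ :=
  -∑ i, q i * Real.logb 2 (q i)

theorem shannonEntropy_nonneg {ι : Type*} [Fintype ι] {q : ι → ℝ} (hq : ∀ i, 0 ≤ q i)
    (hq1 : ∑ i, q i = 1) : 0 ≤ shannonEntropy q := by
  rw [shannonEntropy, neg_nonneg]
  refine Finset.sum_nonpos fun i _ => mul_nonpos_of_nonneg_of_nonpos (hq i)
    (Real.logb_nonpos one_lt_two (hq i) ?_)
  rw [← hq1]
  exact Finset.single_le_sum (fun i _ => hq i) (Finset.mem_univ i)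

theorem vonNeumannEntropy_eq_shannonEntropy {ι : Type*} [Fintype ι] [DecidableEq ι]
    {ρ : Matrix ι ι ℂ} (hρ : ρ.IsHermitian) :
    vonNeumannEntropy ρ = shannonEntropy hρ.eigenvalues := by
  set U := (hρ.eigenvectorUnitary : Matrix ι ι ℂ) with hU
  have hUU : star U * U = 1 := Unitary.star_mul_self_of_mem hρ.eigenvectorUnitary.2
  have h : ρ * cfc (Real.logb 2) ρ = U * (Matrix.diagonal
      (fun i => ((hρ.eigenvalues i * Real.logb 2 (hρ.eigenvalues i) : ℝ) : ℂ)) * star U) := by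
    rw [hρ.cfc_eq, Matrix.IsHermitian.cfc]
    nth_rw 1 [hρ.spectral_theorem]
    rw [← map_mul, Matrix.diagonal_mul_diagonal, Unitary.conjStarAlgAut_apply, Matrix.mul_assoc]
    simp [hU]
  rw [vonNeumannEntropy, h, Matrix.trace_mul_comm, Matrix.mul_assoc, hUU, Matrix.mul_one,
    Matrix.trace_diagonal, ← Complex.ofReal_sum, Complex.ofReal_re, shannonEntropy]

/-! ### Typical words -/

section Typical

variable {ι : Type*} [Fintype ι]

theorem sum_pi_prod_eq_one {q : ι → ℝ} (hq1 : ∑ i, q i = 1) (n : ℕ) :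
    ∑ i : Fin n → ι, ∏ k, q (i k) = 1 := by
  rw [Finset.sum_pi_prod n fun _ => q]
  simp [hq1]

theorem sum_pi_succ {R : Type*} [AddCommMonoid R] (n : ℕ) (f : (Fin (n + 1) → ι) → R) :
    ∑ i, f i = ∑ x, ∑ i : Fin n → ι, f (Fin.cons x i) := by
  rw [← (Fin.consEquiv fun _ => ι).sum_comp, Fintype.sum_prod_type]
  rfl

theorem sum_pi_prod_mul_sum_eq_zero {q h : ι → ℝ} (hq1 : ∑ i, q i = 1)
    (hh : ∑ i, q i * h i = 0) (n : ℕ) :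
    ∑ i : Fin n → ι, (∏ k, q (i k)) * ∑ k, h (i k) = 0 := by
  induction n with
  | zero => simp
  | succ n ih =>
    rw [sum_pi_succ]
    simp only [Fin.prod_univ_succ, Fin.sum_univ_succ, Fin.cons_zero, Fin.cons_succ]
    have e (x : ι) : ∑ i : Fin n → ι, (q x * ∏ k, q (i k)) * (h x + ∑ k, h (i k)) =
        q x * h x * ∑ i : Fin n → ι, ∏ k, q (i k) +
          q x * ∑ i : Fin n → ι, (∏ k, q (i k)) * ∑ k, h (i k) := by
      rw [Finset.mul_sum, Finset.mul_sum, ← Finset.sum_add_distrib]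
      exact Finset.sum_congr rfl fun i _ => by ring
    simp only [e, ih, sum_pi_prod_eq_one hq1, mul_one, mul_zero, add_zero, hh]

/-- Additivity of the variance over independent letters. -/
theorem sum_pi_prod_mul_sum_sq {q h : ι → ℝ} (hq1 : ∑ i, q i = 1)
    (hh : ∑ i, q i * h i = 0) (n : ℕ) :
    ∑ i : Fin n → ι, (∏ k, q (i k)) * (∑ k, h (i k)) ^ 2 = n * ∑ x, q x * h x ^ 2 := by
  induction n with
  | zero => simp
  | succ n ih =>
    rw [sum_pi_succ]
    simp only [Fin.prod_univ_succ, Fin.sum_univ_succ, Fin.cons_zero, Fin.cons_succ]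
    have e (x : ι) : ∑ i : Fin n → ι, (q x * ∏ k, q (i k)) * (h x + ∑ k, h (i k)) ^ 2 =
        q x * h x ^ 2 * ∑ i : Fin n → ι, ∏ k, q (i k) +
          2 * q x * h x * ∑ i : Fin n → ι, (∏ k, q (i k)) * ∑ k, h (i k) +
          q x * ∑ i : Fin n → ι, (∏ k, q (i k)) * (∑ k, h (i k)) ^ 2 := by
      rw [Finset.mul_sum, Finset.mul_sum, Finset.mul_sum, ← Finset.sum_add_distrib,
        ← Finset.sum_add_distrib]
      exact Finset.sum_congr rfl fun i _ => by ring
    simp only [e, ih, sum_pi_prod_eq_one hq1, sum_pi_prod_mul_sum_eq_zero hq1 hh, mul_one,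
      mul_zero, add_zero, Finset.sum_add_distrib, ← Finset.sum_mul, hq1]
    push_cast
    ring

open Classical in
/-- The words of length `n` without letters of probability zero whose information content
`-log₂ (q i₁ ⋯ q iₙ)` is within `n * t` of `n` times the entropy. -/
def typicalSet (q : ι → ℝ) (n : ℕ) (t : ℝ) : Finset (Fin n → ι) :=
  {i | (∀ k, 0 < q (i k)) ∧ |∑ k, (-Real.logb 2 (q (i k)) - shannonEntropy q)| ≤ n * t}

variable {q : ι → ℝ} {n : ℕ} {t : ℝ} {i : Fin n → ι}

theorem mem_typicalSet : i ∈ typicalSet q n t ↔ (∀ k, 0 < q (i k)) ∧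
    |∑ k, (-Real.logb 2 (q (i k)) - shannonEntropy q)| ≤ n * t := by
  simp [typicalSet]

theorem prod_eq_rpow_of_pos (hi : ∀ k, 0 < q (i k)) :
    ∏ k, q (i k) = (2 : ℝ) ^ (-(n * shannonEntropy q) -
      ∑ k, (-Real.logb 2 (q (i k)) - shannonEntropy q)) := by
  have e : -(n * shannonEntropy q) - ∑ k, (-Real.logb 2 (q (i k)) - shannonEntropy q) =
      ∑ k, Real.logb 2 (q (i k)) := by
    simp only [Finset.sum_sub_distrib, Finset.sum_neg_distrib, Finset.sum_const, Finset.card_univ,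
      Fintype.card_fin, nsmul_eq_mul]
    ring
  rw [e, Real.rpow_sum_of_pos two_pos]
  exact Finset.prod_congr rfl fun k _ =>
    (Real.rpow_logb two_pos (by norm_num) (hi k)).symm

theorem prod_le_of_mem_typicalSet (hi : i ∈ typicalSet q n t) :
    ∏ k, q (i k) ≤ (2 : ℝ) ^ (-(n * (shannonEntropy q - t))) := by
  obtain ⟨h0, h1⟩ := mem_typicalSet.1 hi
  rw [prod_eq_rpow_of_pos h0]
  exact Real.rpow_le_rpow_of_exponent_le one_le_two (by linarith [(abs_le.1 h1).1])

theorem le_prod_of_mem_typicalSet (hi : i ∈ typicalSet q n t) :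
    (2 : ℝ) ^ (-(n * (shannonEntropy q + t))) ≤ ∏ k, q (i k) := by
  obtain ⟨h0, h1⟩ := mem_typicalSet.1 hi
  rw [prod_eq_rpow_of_pos h0]
  exact Real.rpow_le_rpow_of_exponent_le one_le_two (by linarith [(abs_le.1 h1).2])

theorem card_typicalSet_le (hq : ∀ x, 0 ≤ q x) (hq1 : ∑ x, q x = 1) (n : ℕ) (t : ℝ) :
    ((typicalSet q n t).card : ℝ) ≤ (2 : ℝ) ^ (n * (shannonEntropy q + t)) := by
  have h : ((typicalSet q n t).card : ℝ) * (2 : ℝ) ^ (-(n * (shannonEntropy q + t))) ≤ 1 := by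
    rw [← sum_pi_prod_eq_one hq1 n, ← nsmul_eq_mul]
    exact (Finset.card_nsmul_le_sum _ _ _ fun i hi => le_prod_of_mem_typicalSet hi).trans
      (Finset.sum_le_univ_sum_of_nonneg fun i => Finset.prod_nonneg fun k _ => hq _)
  rwa [Real.rpow_neg zero_le_two, ← div_eq_mul_inv, div_le_one (by positivity)] at h

/-- Asymptotic equipartition, by Chebyshev's inequality. -/
theorem eventually_sum_compl_typicalSet_lt [DecidableEq ι] (hq : ∀ x, 0 ≤ q x)
    (hq1 : ∑ x, q x = 1) (ht : 0 < t) {η : ℝ} (hη : 0 < η) :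
    ∀ᶠ n : ℕ in atTop, ∑ i ∈ (typicalSet q n t)ᶜ, ∏ k, q (i k) < η := by
  set h : ι → ℝ := fun x => -Real.logb 2 (q x) - shannonEntropy q with hh
  have hmean : ∑ x, q x * h x = 0 := by
    simp only [hh, mul_sub, Finset.sum_sub_distrib, ← Finset.sum_mul, hq1, one_mul, mul_neg,
      Finset.sum_neg_distrib]
    rw [shannonEntropy, sub_self]
  set σ := ∑ x, q x * h x ^ 2
  have hlim : Tendsto (fun n : ℕ => σ / t ^ 2 / (n : ℝ)) atTop (nhds 0) :=
    tendsto_const_div_atTop_nhds_zero_nat _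
  filter_upwards [hlim.eventually (gt_mem_nhds hη), eventually_gt_atTop 0] with n hn hn0
  refine lt_of_le_of_lt ?_ hn
  have hn0' : (0 : ℝ) < n := by exact_mod_cast hn0
  rw [div_div, le_div_iff₀ (by positivity)]
  have hcheb : (n * t) ^ 2 * ∑ i ∈ (typicalSet q n t)ᶜ, ∏ k, q (i k) ≤ n * σ := by
    rw [← sum_pi_prod_mul_sum_sq hq1 hmean, Finset.mul_sum]
    refine (Finset.sum_le_sum fun i hi => ?_).trans
      (Finset.sum_le_univ_sum_of_nonneg fun i =>
        mul_nonneg (Finset.prod_nonneg fun k _ => hq _) (sq_nonneg _))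
    rw [mul_comm]
    by_cases h0 : ∀ k, 0 < q (i k)
    · refine mul_le_mul_of_nonneg_left ?_ (Finset.prod_nonneg fun k _ => hq _)
      rw [Finset.mem_compl, mem_typicalSet, not_and, not_le] at hi
      rw [← sq_abs (∑ k, h (i k))]
      exact pow_le_pow_left₀ (by positivity) (hi h0).le 2
    · -- words containing a letter of probability zero carry no mass
      push Not at h0
      obtain ⟨k, hk⟩ := h0
      have : ∏ k, q (i k) = 0 :=
        Finset.prod_eq_zero (Finset.mem_univ k) (le_antisymm hk (hq _))
      simp [this]
  refine le_of_mul_le_mul_left ?_ hn0'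
  calc _ = (n * t) ^ 2 * ∑ i ∈ (typicalSet q n t)ᶜ, ∏ k, q (i k) := by ring
    _ ≤ _ := hcheb

end Typical

/-! ### The noiseless coding theorem -/

theorem mainTheorem3 {A ι : Type*} [Fintype A] [Fintype ι] [DecidableEq ι]
    (M : QuantumSource A ι) (δ ε : ℝ) (hδ : 0 < δ) (hε : 0 < ε) :
    (∀ᶠ n : ℕ in atTop,
      ∃ T : TranspositionScheme (Fin n → ι) (2 ^ ⌊(n : ℝ) * (vonNeumannEntropy M.density + δ)⌋₊),
        T.DecodesByInverse ∧ 1 - ε < T.fidelity (M.block n)) ∧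
    (∀ᶠ n : ℕ in atTop, ∀ d : ℕ,
      (d : ℝ) ≤ (2 : ℝ) ^ ((n : ℝ) * (vonNeumannEntropy M.density - δ)) →
      ∀ T : TranspositionScheme (Fin n → ι) d, T.fidelity (M.block n) < ε) := by
  have hρ := M.isHermitian_density
  set q := hρ.eigenvalues with hq_def
  set W := star (hρ.eigenvectorUnitary : Matrix ι ι ℂ) with hW_def
  have hWW : Wᴴ * W = 1 := by
    rw [← Matrix.star_eq_conjTranspose, hW_def, star_star]
    exact Unitary.mul_star_self_of_mem hρ.eigenvectorUnitary.2
  have hWW' : W * Wᴴ = 1 := mul_eq_one_comm.1 hWW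
  have hdiag : W * M.density * Wᴴ = Matrix.diagonal fun i => (q i : ℂ) := by
    have h := hρ.conjStarAlgAut_star_eigenvectorUnitary
    rw [Unitary.conjStarAlgAut_apply] at h
    exact h
  have hq := QuantumSource.weight_nonneg_of_diagonal hdiag
  have hq1 := QuantumSource.sum_weight_of_diagonal hWW hdiag
  rw [vonNeumannEntropy_eq_shannonEntropy hρ, ← hq_def]
  set H := shannonEntropy q with hH
  have hV (n : ℕ) : (tensorPower n W)ᴴ * tensorPower n W = 1 := by
    rw [← tensorPower_conjTranspose, ← tensorPower_mul, hWW, tensorPower_one]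
  have hdiagn (n : ℕ) : tensorPower n W * (M.block n).density * (tensorPower n W)ᴴ =
      Matrix.diagonal fun i => ((∏ k, q (i k) : ℝ) : ℂ) := by
    rw [M.density_block, ← tensorPower_conjTranspose, ← tensorPower_mul, ← tensorPower_mul, hdiag,
      tensorPower_diagonal]
    simp
  have hδ2 : 0 < δ / 2 := half_pos hδ
  have hε2 : 0 < ε / 2 := half_pos hε
  have hH0 : 0 ≤ H := shannonEntropy_nonneg hq hq1
  have htyp := eventually_sum_compl_typicalSet_lt hq hq1 hδ2 hε2
  constructor
  · -- once `n * δ / 2 ≥ 1`, the gap between `δ` and `δ / 2` absorbs the rounding down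
    filter_upwards [htyp, eventually_ge_atTop ⌈2 / δ⌉₊] with n hn hnδ
    have hnδ' : 1 ≤ n * (δ / 2) := by
      have := Nat.ceil_le.1 hnδ
      rw [div_le_iff₀ hδ] at this
      linarith
    have hcard : (typicalSet q n (δ / 2)).card ≤ 2 ^ ⌊(n : ℝ) * (H + δ)⌋₊ := by
      have h1 := card_typicalSet_le hq hq1 n (δ / 2)
      have h2 : (n : ℝ) * (H + δ / 2) ≤ (⌊(n : ℝ) * (H + δ)⌋₊ : ℝ) := by
        have := Nat.lt_floor_add_one ((n : ℝ) * (H + δ))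
        linarith
      have h3 := h1.trans (Real.rpow_le_rpow_of_exponent_le one_le_two h2)
      rw [Real.rpow_natCast] at h3
      exact_mod_cast h3
    obtain ⟨T, hT, hF⟩ := TranspositionScheme.exists_fidelity_ge (hV n) (hdiagn n)
      (pow_pos two_pos _) _ hcard
    refine ⟨T, hT, lt_of_lt_of_le ?_ hF⟩
    have hsum := sum_pi_prod_eq_one hq1 n
    rw [← Finset.sum_compl_add_sum (typicalSet q n (δ / 2))] at hsum
    linarith
  · have hlim : Tendsto (fun n : ℕ => ((2 : ℝ) ^ (-(δ / 2))) ^ n) atTop (nhds 0) :=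
      tendsto_pow_atTop_nhds_zero_of_lt_one (by positivity)
        (Real.rpow_lt_one_of_one_lt_of_neg one_lt_two (by linarith))
    filter_upwards [htyp, hlim.eventually (gt_mem_nhds hε2)] with n hn hn' d hd T
    have hF := T.fidelity_le (mul_eq_one_comm.1 (hV n)) (hV n) (hdiagn n) (typicalSet q n (δ / 2))
      (Real.rpow_nonneg zero_le_two _) fun i hi => prod_le_of_mem_typicalSet hi
    have hd' : (d : ℝ) * (2 : ℝ) ^ (-(n * (H - δ / 2))) ≤ ((2 : ℝ) ^ (-(δ / 2))) ^ n := by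
      refine (mul_le_mul_of_nonneg_right hd (Real.rpow_nonneg zero_le_two _)).trans (le_of_eq ?_)
      rw [← Real.rpow_add two_pos, ← Real.rpow_natCast, ← Real.rpow_mul zero_le_two]
      congr 1
      ring
    linarith

end
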